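/- Let $\mathbb{K}\in\{\mathbb{R},\mathbb{C}\}$, let $\Omega\subseteq\mathbb{R}^d$ be open, and let $p\in\{1,2,3,\dots\}\cup\{\infty\}$. Let $C^p(\Omega,\mathbb{K})$ be the space of $\mathbb{K}$-valued functions on $\Omega$ all of whose partial derivatives of order at most $p$ (of every order, if $p=\infty$) exist and are continuous, with the topology given by the seminorms $$\|f\|_{K,n}=\max_{|\alpha|\le n}\ \max_{x\in K}\ \Big|\frac{\partial^{|\alpha|}f}{\partial x^\alpha}(x)\Big| ,\qquad K\subset\Omega \text{ compact},\quad n\in\{0,1,2,\dots\},\ n\le p .$$ Let $\psi:\Omega\to\Omega$ be a map of class $C^p$, let $\omega\in C^p(\Omega,\mathbb{K})$, and let $$C_{\omega,\psi}:C^p(\Omega,\mathbb{K})\to C^p(\Omega,\mathbb{K}),\qquad C_{\omega,\psi}f=\omega\cdot(f\circ\psi).$$ A linear operator $T$ on a topological vector space $X$ is called mixing (respectively, transitive) if for all non-empty open sets $U,V\subseteq X$ one has $T^n(U)\cap V\neq\emptyset$ for all large $n$ (respectively, for some $n\ge 1$); it is called chaotic if it is transitive and its set $\bigcup_{n\ge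 1}\ker(T^n-I)$ of periodic points is dense in $X$. If $C_{\omega,\psi}$ is mixing on $C^p(\Omega,\mathbb{K})$, then $C_{\omega,\psi}$ is chaotic on $C^p(\Omega,\mathbb{K})$. -/

import Mathlib

open TopologicalSpace

noncomputable section

/-- `f : Ω → F` is of class `C^p` on the open set `Ω ⊆ ℝ^d`. (Functions on `Ω` are extended by
zero in order to speak about derivatives; only the values on `Ω` matter, since `Ω` is open.) -/
def IsCp {d : ℕ} {Ω : Opens (EuclideanSpace ℝ (Fin d))} {F : Type*} [NormedAddCommGroup F]
    [NormedSpace ℝ F] (p : ℕ∞) (f : Ω → F) : Prop :=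
  ContDiffOn ℝ p (Function.extend Subtype.val f 0) (Ω : Set (EuclideanSpace ℝ (Fin d)))

section aux

variable {d : ℕ} {Ω : Opens (EuclideanSpace ℝ (Fin d))} {F : Type*}

theorem extend_val_apply [Zero F] (f : Ω → F) (x : Ω) :
    Function.extend Subtype.val f 0 (x : EuclideanSpace ℝ (Fin d)) = f x :=
  Subtype.val_injective.extend_apply f 0 x

theorem extend_val_add [AddZeroClass F] (f g : Ω → F) :
    Function.extend Subtype.val (f + g) (0 : EuclideanSpace ℝ (Fin d) → F) =
      Function.extend Subtype.val f 0 + Function.extend Subtype.val g 0 := by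
  have h := Function.extend_add (Subtype.val : Ω → EuclideanSpace ℝ (Fin d)) f g 0 0
  rwa [add_zero] at h

variable [NormedAddCommGroup F] [NormedSpace ℝ F]

theorem isCp_iff_of_eqOn {p : ℕ∞} {f : Ω → F} {g : EuclideanSpace ℝ (Fin d) → F}
    (h : ∀ x : Ω, g x = f x) : IsCp p f ↔ ContDiffOn ℝ p g Ω := by
  refine contDiffOn_congr fun x hx => ?_
  rw [h ⟨x, hx⟩]
  exact extend_val_apply f ⟨x, hx⟩

theorem IsCp.contDiffAt {p : ℕ∞} {f : Ω → F} (hf : IsCp p f) (x : Ω) :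
    ContDiffAt ℝ p (Function.extend Subtype.val f 0) (x : EuclideanSpace ℝ (Fin d)) :=
  ContDiffOn.contDiffAt hf (Ω.isOpen.mem_nhds x.2)

theorem extend_val_smul {𝕜 : Type*} [RCLike 𝕜] (c : 𝕜) (f : Ω → 𝕜) :
    Function.extend Subtype.val (c • f) (0 : EuclideanSpace ℝ (Fin d) → 𝕜) =
      c • Function.extend Subtype.val f 0 := by
  have h := Function.extend_smul c (Subtype.val : Ω → EuclideanSpace ℝ (Fin d)) f 0
  rwa [smul_zero] at h

end aux

/-- The `𝕜`-vector space of `C^p` functions `Ω → 𝕜`, as a subspace of all functions. -/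
def cpSubmodule (𝕜 : Type*) [RCLike 𝕜] {d : ℕ} (Ω : Opens (EuclideanSpace ℝ (Fin d))) (p : ℕ∞) :
    Submodule 𝕜 (Ω → 𝕜) where
  carrier := {f | IsCp p f}
  zero_mem' := (isCp_iff_of_eqOn (g := fun _ => 0) fun _ => rfl).2 contDiffOn_const
  add_mem' := by
    intro f g hf hg
    change ContDiffOn ℝ p _ _
    rw [extend_val_add]
    exact ContDiffOn.add hf hg
  smul_mem' := by
    intro c f hf
    change ContDiffOn ℝ p _ _
    rw [extend_val_smul]
    exact ContDiffOn.const_smul c hf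

/-- The space `C^p(Ω, 𝕜)`. It is a type of its own, so that it does not inherit the topology of
pointwise convergence; its topology is defined below. -/
def CpSpace (𝕜 : Type*) [RCLike 𝕜] {d : ℕ} (Ω : Opens (EuclideanSpace ℝ (Fin d))) (p : ℕ∞) :
    Type _ :=
  ↥(cpSubmodule 𝕜 Ω p)

namespace CpSpace

variable {𝕜 : Type*} [RCLike 𝕜] {d : ℕ} {Ω : Opens (EuclideanSpace ℝ (Fin d))} {p : ℕ∞}

instance : AddCommGroup (CpSpace 𝕜 Ω p) := inferInstanceAs (AddCommGroup ↥(cpSubmodule 𝕜 Ω p))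

instance : Module 𝕜 (CpSpace 𝕜 Ω p) := inferInstanceAs (Module 𝕜 ↥(cpSubmodule 𝕜 Ω p))

instance : FunLike (CpSpace 𝕜 Ω p) Ω 𝕜 where
  coe f := f.1
  coe_injective _ _ h := Subtype.ext h

/-- A function of class `C^p`, as an element of `C^p(Ω, 𝕜)`. -/
def mk (f : Ω → 𝕜) (hf : IsCp p f) : CpSpace 𝕜 Ω p := ⟨f, hf⟩

theorem isCp (f : CpSpace 𝕜 Ω p) : IsCp p (f : Ω → 𝕜) := f.2

@[simp] theorem coe_mk (f : Ω → 𝕜) (hf : IsCp p f) : (mk f hf : Ω → 𝕜) = f := rfl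

@[simp] theorem coe_add (f g : CpSpace 𝕜 Ω p) : ((f + g : CpSpace 𝕜 Ω p) : Ω → 𝕜) = f + g := rfl

@[simp] theorem coe_smul (c : 𝕜) (f : CpSpace 𝕜 Ω p) :
    ((c • f : CpSpace 𝕜 Ω p) : Ω → 𝕜) = c • (f : Ω → 𝕜) := rfl

/-- The partial derivative `∂_{w 0} ∂_{w 1} ⋯ ∂_{w (k-1)} f` of order `k` on `Ω`. By the symmetry
of higher derivatives, for `k ≤ p` and `f` of class `C^p` these are, as `w` varies, exactly the
derivatives `∂^α f` with `α` a multi-index of length `|α| = k`. -/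
def partialDeriv {k : ℕ} (w : Fin k → Fin d) (f : Ω → 𝕜) (x : Ω) : 𝕜 :=
  iteratedFDeriv ℝ k (Function.extend Subtype.val f 0) (x : EuclideanSpace ℝ (Fin d))
    fun j => EuclideanSpace.single (w j) (1 : ℝ)

theorem continuous_partialDeriv {k : ℕ} (hk : (k : ℕ∞) ≤ p) (w : Fin k → Fin d)
    (f : CpSpace 𝕜 Ω p) : Continuous (partialDeriv w f) := by
  refine continuous_iff_continuousAt.2 fun x => ?_
  have h : ContinuousAt
      (iteratedFDeriv ℝ k (Function.extend Subtype.val (f : Ω → 𝕜) 0))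
      (x : EuclideanSpace ℝ (Fin d)) := by
    have h1 := ((isCp f).contDiffAt x).iteratedFDeriv_right (i := k) (m := 0)
      (by rw [zero_add]; exact_mod_cast hk)
    exact h1.continuousAt
  have h2 := h.comp (f := (Subtype.val : Ω → EuclideanSpace ℝ (Fin d)))
    continuous_subtype_val.continuousAt
  exact ((ContinuousMultilinearMap.apply ℝ (fun _ : Fin k => EuclideanSpace ℝ (Fin d)) 𝕜
    fun j => EuclideanSpace.single (w j) (1 : ℝ)).continuous.continuousAt).comp h2

/-- Partial differentiation of order `k ≤ p`, followed by restriction to the compact set `K`, as a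
linear map from `C^p(Ω, 𝕜)` to the continuous functions on `K`. -/
def partialDerivOn (K : Compacts Ω) {k : ℕ} (hk : (k : ℕ∞) ≤ p) (w : Fin k → Fin d) :
    CpSpace 𝕜 Ω p →ₗ[𝕜] C(K, 𝕜) where
  toFun f := ⟨fun x => partialDeriv w f x,
    (continuous_partialDeriv hk w f).comp continuous_subtype_val⟩
  map_add' f g := by
    ext x
    have hk' : (k : WithTop ℕ∞) ≤ (p : WithTop ℕ∞) := by exact_mod_cast hk
    change partialDeriv w ((f : Ω → 𝕜) + (g : Ω → 𝕜)) x = partialDeriv w f x + partialDeriv w g x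
    unfold partialDeriv
    rw [extend_val_add, iteratedFDeriv_add_apply (((isCp f).contDiffAt x).of_le hk')
      (((isCp g).contDiffAt x).of_le hk')]
    rfl
  map_smul' c f := by
    ext x
    have hk' : (k : WithTop ℕ∞) ≤ (p : WithTop ℕ∞) := by exact_mod_cast hk
    change partialDeriv w (c • (f : Ω → 𝕜)) x = c • partialDeriv w f x
    unfold partialDeriv
    rw [extend_val_smul, iteratedFDeriv_const_smul_apply (((isCp f).contDiffAt x).of_le hk')]
    rfl

/-- The seminorm `‖f‖_{K,n}`, `n ≤ p`: the maximum over all partial derivatives of `f` of order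
at most `n` of the maximum of their absolute value on the compact set `K` (the norm of `C(K, 𝕜)`
is the maximum norm). -/
def cpSeminorm (K : Compacts Ω) (n : {n : ℕ // (n : ℕ∞) ≤ p}) : Seminorm 𝕜 (CpSpace 𝕜 Ω p) :=
  (Finset.univ : Finset (Σ k : Fin (n.1 + 1), Fin k → Fin d)).sup fun w =>
    (normSeminorm 𝕜 C(K, 𝕜)).comp
      (partialDerivOn K (le_trans (Nat.cast_le.2 (Nat.lt_succ_iff.1 w.1.2)) n.2) w.2)

/-- The family of all the seminorms `‖·‖_{K,n}`, `K ⊆ Ω` compact and `n ≤ p` a natural number. -/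
def cpSeminormFamily (𝕜 : Type*) [RCLike 𝕜] {d : ℕ} (Ω : Opens (EuclideanSpace ℝ (Fin d)))
    (p : ℕ∞) : SeminormFamily 𝕜 (CpSpace 𝕜 Ω p) (Compacts Ω × {n : ℕ // (n : ℕ∞) ≤ p}) :=
  fun i => cpSeminorm i.1 i.2

instance : Nonempty (Compacts Ω × {n : ℕ // (n : ℕ∞) ≤ p}) := ⟨(⊥, ⟨0, by simp⟩)⟩

/-- The topology of `C^p(Ω, 𝕜)` defined by the seminorms `‖·‖_{K,n}`. -/
instance : TopologicalSpace (CpSpace 𝕜 Ω p) :=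
  (cpSeminormFamily 𝕜 Ω p).moduleFilterBasis.topology

theorem withSeminorms : WithSeminorms (cpSeminormFamily 𝕜 Ω p) := ⟨rfl⟩

end CpSpace

section

variable {𝕜 : Type*} [RCLike 𝕜] {d : ℕ} {Ω : Opens (EuclideanSpace ℝ (Fin d))} {p : ℕ∞}

theorem IsCp.weightedComp {ω : Ω → 𝕜} {ψ : Ω → Ω} (hω : IsCp p ω)
    (hψ : IsCp p fun x => (ψ x : EuclideanSpace ℝ (Fin d))) {f : Ω → 𝕜} (hf : IsCp p f) :
    IsCp p fun x => ω x * f (ψ x) := by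
  have h : ContDiffOn ℝ p (fun x => Function.extend Subtype.val ω 0 x *
      Function.extend Subtype.val f 0 (Function.extend Subtype.val
        (fun x => (ψ x : EuclideanSpace ℝ (Fin d))) 0 x))
      (Ω : Set (EuclideanSpace ℝ (Fin d))) := by
    refine ContDiffOn.mul hω (ContDiffOn.comp hf hψ fun x hx => ?_)
    have e := extend_val_apply (fun x : Ω => (ψ x : EuclideanSpace ℝ (Fin d))) ⟨x, hx⟩
    rw [e]
    exact (ψ ⟨x, hx⟩).2
  refine (isCp_iff_of_eqOn fun x => ?_).2 h
  simp only [extend_val_apply]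

/-- The weighted composition operator `C_{ω,ψ} : f ↦ ω · (f ∘ ψ)` on `C^p(Ω, 𝕜)`. -/
def weightedComp (ω : Ω → 𝕜) (hω : IsCp p ω) (ψ : Ω → Ω)
    (hψ : IsCp p fun x => (ψ x : EuclideanSpace ℝ (Fin d))) :
    CpSpace 𝕜 Ω p →ₗ[𝕜] CpSpace 𝕜 Ω p where
  toFun f := CpSpace.mk (fun x => ω x * f (ψ x)) (hω.weightedComp hψ f.isCp)
  map_add' f g := DFunLike.coe_injective <| funext fun x => mul_add (ω x) (f (ψ x)) (g (ψ x))
  map_smul' c f := DFunLike.coe_injective <| funext fun x => mul_left_comm (ω x) c (f (ψ x))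

end

section

variable {𝕜 X : Type*} [Field 𝕜] [AddCommGroup X] [Module 𝕜 X] [TopologicalSpace X]

/-- `T` is transitive: for all non-empty open `U`, `V`, the set `T^n(U)` meets `V` for some
positive integer `n`. -/
def IsTransitiveOp (T : X →ₗ[𝕜] X) : Prop :=
  ∀ U V : Set X, IsOpen U → IsOpen V → U.Nonempty → V.Nonempty →
    ∃ n : ℕ, 1 ≤ n ∧ ((T ^ n) '' U ∩ V).Nonempty

/-- `T` is mixing: for all non-empty open `U`, `V`, the set `T^n(U)` meets `V` for all large
`n`. -/
def IsMixingOp (T : X →ₗ[𝕜] X) : Prop :=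
  ∀ U V : Set X, IsOpen U → IsOpen V → U.Nonempty → V.Nonempty →
    ∃ N : ℕ, ∀ n : ℕ, N ≤ n → ((T ^ n) '' U ∩ V).Nonempty

/-- `T` is chaotic: it is transitive and its set `⋃_{n ≥ 1} ker (T^n - I)` of periodic points is
dense. -/
def IsChaoticOp (T : X →ₗ[𝕜] X) : Prop :=
  IsTransitiveOp T ∧
    Dense (⋃ (n : ℕ) (_ : 1 ≤ n), (LinearMap.ker (T ^ n - LinearMap.id) : Set X))

end

end

/-! Write `T` for the operator. Transitivity gives `T` dense range, so a continuous functional that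
annihilates the range is zero. Testing with point evaluations and first derivatives shows that `ω`
has no zeros, that `ψ` is injective and that its derivative is injective everywhere, so `ψ` is a
local diffeomorphism. Mixing also makes `ψ` strongly run-away
(`IsMixingOp.exists_disjoint_iterate`): for compact `K`, `ψ^n(K)` misses `K` for all large `n`.

Conversely, these properties produce periodic points. Cut `f` off to `h`, supported in a compact
`K'` and equal to `f` near `K`. Since `h` can be pulled back along `T` indefinitely
(`CpSpace.exists_preimage`), the series `g = ∑_{j ∈ ℤ} T^{Nj} h` makes sense formally. Its terms
live on the preimages of `K'` under `ψ^{Nj}` and on the images `ψ^{Nj}(K')`. By run-away these sets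
leave every compact set, so the sum is locally finite, of class `C^p` and fixed by `T^N`. If `N` is
large, only the term `j = 0` survives on `K'`, so `g = f` near `K`. The topology only sees
neighbourhoods of compact sets, hence density. -/

noncomputable section

open Filter Topology

/-! ### Local nature of the class `C^p`. -/

section local_properties

variable {d : ℕ} {Ω : Opens (EuclideanSpace ℝ (Fin d))} {F : Type*}

/-- A property that holds near `x` in `Ω` gives an equality of extensions near `x` in `ℝ^d`. -/
theorem extend_val_eventuallyEq [Zero F] {f : Ω → F} {g : EuclideanSpace ℝ (Fin d) → F} {x : Ω}
    (h : ∀ᶠ y in 𝓝 x, f y = g y) :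
    Function.extend Subtype.val f 0 =ᶠ[𝓝 (x : EuclideanSpace ℝ (Fin d))] g := by
  have h' := Ω.isOpen.isOpenEmbedding_subtypeVal.map_nhds_eq x
  rw [EventuallyEq, ← h', eventually_map]
  filter_upwards [h] with y hy
  rw [extend_val_apply, hy]

variable [NormedAddCommGroup F] [NormedSpace ℝ F]

theorem isCp_iff_contDiffAt {p : ℕ∞} {f : Ω → F} :
    IsCp p f ↔ ∀ x : Ω, ContDiffAt ℝ p (Function.extend Subtype.val f 0)
      (x : EuclideanSpace ℝ (Fin d)) :=
  ⟨fun h x => h.contDiffAt x, fun h x hx => (h ⟨x, hx⟩).contDiffWithinAt⟩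

/-- Being of class `C^p` is a local property. -/
theorem isCp_of_locally {p : ℕ∞} {f : Ω → F}
    (h : ∀ x : Ω, ∃ g : EuclideanSpace ℝ (Fin d) → F, ContDiffAt ℝ p g x ∧
      ∀ᶠ y in 𝓝 x, f y = g y) : IsCp p f := by
  refine isCp_iff_contDiffAt.2 fun x => ?_
  obtain ⟨g, hg, he⟩ := h x
  exact hg.congr_of_eventuallyEq (extend_val_eventuallyEq he)

theorem IsCp.continuous {p : ℕ∞} {f : Ω → F} (hf : IsCp p f) : Continuous f := by
  have h := continuousOn_iff_continuous_domRestrict.1 (ContDiffOn.continuousOn hf)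
  convert! h using 1
  funext x
  exact (extend_val_apply f x).symm

theorem continuous_of_isCp_val {p : ℕ∞} {ψ : Ω → Ω}
    (hψ : IsCp p fun x => (ψ x : EuclideanSpace ℝ (Fin d))) : Continuous ψ :=
  continuous_induced_rng.2 hψ.continuous

end local_properties

/-! ### Continuous functionals, approximation and test functions in `C^p(Ω, 𝕜)`. -/

namespace CpSpace

variable {𝕜 : Type*} [RCLike 𝕜] {d : ℕ} {Ω : Opens (EuclideanSpace ℝ (Fin d))} {p : ℕ∞}

theorem ext_apply {f g : CpSpace 𝕜 Ω p} (h : ∀ x, f x = g x) : f = g :=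
  DFunLike.ext _ _ h

@[simp] theorem sub_apply (f g : CpSpace 𝕜 Ω p) (x : Ω) : (f - g) x = f x - g x := rfl

@[simp] theorem add_apply (f g : CpSpace 𝕜 Ω p) (x : Ω) : (f + g) x = f x + g x := rfl

theorem norm_partialDerivOn_le {k : ℕ} (K : Compacts Ω) (n : {n : ℕ // (n : ℕ∞) ≤ p})
    (hk : k ≤ n.1) (w : Fin k → Fin d) (f : CpSpace 𝕜 Ω p) :
    ‖partialDerivOn K ((Nat.cast_le.2 hk).trans n.2) w f‖ ≤ cpSeminorm K n f := by
  have h := Finset.le_sup (s := (Finset.univ : Finset (Σ k : Fin (n.1 + 1), Fin k → Fin d)))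
    (f := fun w => (normSeminorm 𝕜 C(K, 𝕜)).comp
      (partialDerivOn (𝕜 := 𝕜) (p := p) K
        (le_trans (Nat.cast_le.2 (Nat.lt_succ_iff.1 w.1.2)) n.2) w.2))
    (Finset.mem_univ ⟨⟨k, Nat.lt_succ_of_le hk⟩, w⟩)
  exact h f

theorem continuous_partialDerivOn {k : ℕ} (K : Compacts Ω) (hk : (k : ℕ∞) ≤ p)
    (w : Fin k → Fin d) : Continuous (partialDerivOn (𝕜 := 𝕜) K hk w) := by
  refine WithSeminorms.continuous_normedSpace_rng _ withSeminorms _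
    ⟨{(K, ⟨k, hk⟩)}, 1, fun f => ?_⟩
  simpa [cpSeminormFamily] using norm_partialDerivOn_le K ⟨k, hk⟩ le_rfl w f

theorem continuous_partialDeriv_apply {k : ℕ} (hk : (k : ℕ∞) ≤ p) (w : Fin k → Fin d) (x : Ω) :
    Continuous fun f : CpSpace 𝕜 Ω p => partialDeriv w f x :=
  (continuous_eval_const (F := C((⟨{x}, isCompact_singleton⟩ : Compacts Ω), 𝕜)) (⟨x, rfl⟩ : (⟨{x}, isCompact_singleton⟩ : Compacts Ω))).comp
    (continuous_partialDerivOn ⟨{x}, isCompact_singleton⟩ hk w)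

theorem partialDeriv_zero (w : Fin 0 → Fin d) (f : Ω → 𝕜) (x : Ω) : partialDeriv w f x = f x := by
  rw [partialDeriv, iteratedFDeriv_zero_apply, extend_val_apply]

theorem partialDeriv_one (w : Fin 1 → Fin d) (f : Ω → 𝕜) (x : Ω) :
    partialDeriv w f x = fderiv ℝ (Function.extend Subtype.val f 0)
      (x : EuclideanSpace ℝ (Fin d)) (EuclideanSpace.single (w 0) 1) := by
  rw [partialDeriv, iteratedFDeriv_one_apply]

theorem continuous_eval (x : Ω) : Continuous fun f : CpSpace 𝕜 Ω p => f x := by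
  simpa only [partialDeriv_zero] using
    continuous_partialDeriv_apply (𝕜 := 𝕜) (p := p) (by simp) Fin.elim0 x

/-- Expanding `v` in the standard basis reduces this to first partial derivatives at `x`, which the
seminorms control because `1 ≤ p`. -/
theorem continuous_fderiv_apply (hp : 1 ≤ p) (x : Ω) (v : EuclideanSpace ℝ (Fin d)) :
    Continuous fun f : CpSpace 𝕜 Ω p => fderiv ℝ (Function.extend Subtype.val f 0)
      (x : EuclideanSpace ℝ (Fin d)) v := by
  have hv : v = ∑ i, v i • EuclideanSpace.single i (1 : ℝ) := by
    simpa using ((EuclideanSpace.basisFun (Fin d) ℝ).sum_repr v).symm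
  rw [hv]
  simp only [map_sum, map_smul]
  refine continuous_finsetSum _ fun i _ => Continuous.const_smul ?_ _
  simpa only [partialDeriv_one] using
    continuous_partialDeriv_apply (𝕜 := 𝕜) (by simpa using hp) (fun _ : Fin 1 => i) x

/-- The restriction to a compact set, as a linear map into the continuous functions. -/
def restrictOn (K : Compacts Ω) : CpSpace 𝕜 Ω p →ₗ[𝕜] C(K, 𝕜) :=
  partialDerivOn K (by simp) (Fin.elim0 : Fin 0 → Fin d)

theorem restrictOn_apply (K : Compacts Ω) (f : CpSpace 𝕜 Ω p) (x : K) :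
    restrictOn K f x = f x :=
  partialDeriv_zero Fin.elim0 _ _

theorem continuous_restrictOn (K : Compacts Ω) : Continuous (restrictOn (𝕜 := 𝕜) (p := p) K) :=
  continuous_partialDerivOn K _ _

theorem cpSeminorm_eq_zero {K : Compacts Ω} {n : {n : ℕ // (n : ℕ∞) ≤ p}} {f : CpSpace 𝕜 Ω p}
    (h : ∀ x ∈ K, ∀ᶠ y in 𝓝 x, f y = 0) : cpSeminorm K n f = 0 := by
  refine le_antisymm (Seminorm.finset_sup_apply_le le_rfl fun w _ => le_of_eq ?_) (apply_nonneg _ _)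
  rw [Seminorm.comp_apply, coe_normSeminorm, norm_eq_zero]
  ext x
  have h' := (extend_val_eventuallyEq (g := 0) (h x x.2)).iteratedFDeriv ℝ w.1
  change partialDeriv w.2 f x = 0
  rw [partialDeriv, h'.eq_of_nhds]
  simp

/-- A set containing, for every compact set, an element that coincides with `f` near that set,
has `f` in its closure. -/
theorem mem_closure_of_eventually_eq {s : Set (CpSpace 𝕜 Ω p)} {f : CpSpace 𝕜 Ω p}
    (h : ∀ K : Compacts Ω, ∃ g ∈ s, ∀ x ∈ K, ∀ᶠ y in 𝓝 x, g y = f y) : f ∈ closure s := by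
  rw [mem_closure_iff_nhds]
  intro U hU
  -- A basic neighbourhood involves finitely many seminorms; agreement near the union of their
  -- compact sets annihilates all of them, whatever their orders.
  obtain ⟨t, r, hr, hU⟩ := (withSeminorms.mem_nhds_iff f U).1 hU
  obtain ⟨g, hg, hgf⟩ := h (t.sup Prod.fst)
  refine ⟨g, hU ?_, hg⟩
  rw [Seminorm.mem_ball]
  refine (Seminorm.finset_sup_apply_le le_rfl fun i hi => le_of_eq ?_).trans_lt hr
  refine cpSeminorm_eq_zero fun x hx => ?_
  have hle : i.1 ≤ t.sup Prod.fst := Finset.le_sup (f := Prod.fst) hi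
  filter_upwards [hgf x (hle hx)] with y hy
  simp [hy]

/-- A smooth function on `ℝ^d`, restricted to `Ω`. -/
def ofContDiff (g : EuclideanSpace ℝ (Fin d) → 𝕜) (hg : ContDiff ℝ p g) : CpSpace 𝕜 Ω p :=
  mk (fun x => g x) ((isCp_iff_of_eqOn fun _ => rfl).2 hg.contDiffOn)

@[simp] theorem ofContDiff_apply (g : EuclideanSpace ℝ (Fin d) → 𝕜) (hg : ContDiff ℝ p g)
    (x : Ω) : (ofContDiff g hg : CpSpace 𝕜 Ω p) x = g x := rfl

theorem fderiv_ofContDiff (g : EuclideanSpace ℝ (Fin d) → 𝕜) (hg : ContDiff ℝ p g) (x : Ω) :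
    fderiv ℝ (Function.extend Subtype.val (ofContDiff g hg : CpSpace 𝕜 Ω p) 0)
      (x : EuclideanSpace ℝ (Fin d)) = fderiv ℝ g x :=
  (extend_val_eventuallyEq (Eventually.of_forall fun _ => rfl)).fderiv_eq

theorem contDiff_coordSub (i : Fin d) (c : ℝ) :
    ContDiff ℝ p fun y : EuclideanSpace ℝ (Fin d) => ((y i - c : ℝ) : 𝕜) :=
  (RCLike.ofRealCLM (K := 𝕜)).contDiff.comp
    ((EuclideanSpace.proj i : EuclideanSpace ℝ (Fin d) →L[ℝ] ℝ).contDiff.sub contDiff_const)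

/-- The affine function `y ↦ y i - c`. -/
def coordSub (i : Fin d) (c : ℝ) : CpSpace 𝕜 Ω p :=
  ofContDiff (fun y => ((y i - c : ℝ) : 𝕜)) (contDiff_coordSub i c)

theorem coordSub_apply (i : Fin d) (c : ℝ) (x : Ω) :
    (coordSub i c : CpSpace 𝕜 Ω p) x = ((x.1 i - c : ℝ) : 𝕜) := rfl

theorem fderiv_coordSub (i : Fin d) (c : ℝ) (x : Ω) (v : EuclideanSpace ℝ (Fin d)) :
    fderiv ℝ (Function.extend Subtype.val (coordSub i c : CpSpace 𝕜 Ω p) 0)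
      (x : EuclideanSpace ℝ (Fin d)) v = ((v i : ℝ) : 𝕜) := by
  rw [coordSub, fderiv_ofContDiff]
  have h1 : HasFDerivAt (fun y : EuclideanSpace ℝ (Fin d) => y i - c)
      (EuclideanSpace.proj i : EuclideanSpace ℝ (Fin d) →L[ℝ] ℝ) x.1 :=
    (EuclideanSpace.proj i : EuclideanSpace ℝ (Fin d) →L[ℝ] ℝ).hasFDerivAt.sub_const c
  have h2 := (RCLike.ofRealCLM (K := 𝕜)).hasFDerivAt.comp x.1 h1
  rw [show fderiv ℝ (fun y : EuclideanSpace ℝ (Fin d) => ((y i - c : ℝ) : 𝕜)) x.1 = _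
    from h2.fderiv]
  simp

end CpSpace

/-! ### Necessary conditions on the weight and the symbol. -/

theorem IsMixingOp.isTransitiveOp {𝕜 X : Type*} [Field 𝕜] [AddCommGroup X] [Module 𝕜 X]
    [TopologicalSpace X] {T : X →ₗ[𝕜] X} (hT : IsMixingOp T) : IsTransitiveOp T := by
  intro U V hU hV hU' hV'
  obtain ⟨N, hN⟩ := hT U V hU hV hU' hV'
  exact ⟨max N 1, le_max_right _ _, hN _ (le_max_left _ _)⟩

/-- A continuous function vanishing on the range of a transitive operator vanishes. -/
theorem IsTransitiveOp.eq_zero_of_forall {𝕜 X Y : Type*} [Field 𝕜] [AddCommGroup X] [Module 𝕜 X]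
    [TopologicalSpace X] [TopologicalSpace Y] [Zero Y] [T1Space Y] {T : X →ₗ[𝕜] X}
    (hT : IsTransitiveOp T) {L : X → Y} (hL : Continuous L) (h : ∀ f, L (T f) = 0) (f : X) :
    L f = 0 := by
  by_contra hf
  obtain ⟨n, hn, _, ⟨g, -, rfl⟩, hg⟩ := hT Set.univ (L ⁻¹' {0}ᶜ) isOpen_univ
    (isOpen_compl_singleton.preimage hL) ⟨f, trivial⟩ ⟨f, hf⟩
  obtain ⟨m, rfl⟩ := Nat.exists_eq_add_of_le' hn
  rw [pow_succ'] at hg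
  exact hg (h _)

section necessity

variable {𝕜 : Type*} [RCLike 𝕜] {d : ℕ} {Ω : Opens (EuclideanSpace ℝ (Fin d))} {p : ℕ∞}
  {ω : Ω → 𝕜} {hω : IsCp p ω} {ψ : Ω → Ω} {hψ : IsCp p fun x => (ψ x : EuclideanSpace ℝ (Fin d))}

@[simp] theorem weightedComp_apply (f : CpSpace 𝕜 Ω p) (x : Ω) :
    weightedComp ω hω ψ hψ f x = ω x * f (ψ x) := rfl

theorem weight_ne_zero (hT : IsTransitiveOp (weightedComp ω hω ψ hψ)) (x : Ω) : ω x ≠ 0 := by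
  intro hx
  have h := hT.eq_zero_of_forall (CpSpace.continuous_eval x) (fun f => by simp [hx])
    (CpSpace.ofContDiff (fun _ => 1) contDiff_const)
  simp at h

/-- If `ψ x = ψ y`, the functional `f ↦ ω y * f x - ω x * f y` annihilates the range, but not a
coordinate function that vanishes at `y` and not at `x`. -/
theorem symbol_injective (hT : IsTransitiveOp (weightedComp ω hω ψ hψ)) :
    Function.Injective ψ := by
  intro x y hxy
  by_contra hne
  have hne' : (x : EuclideanSpace ℝ (Fin d)) ≠ y := fun h => hne (Subtype.ext h)
  obtain ⟨i, hi⟩ : ∃ i, x.1 i ≠ y.1 i := by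
    by_contra! h
    exact hne' (PiLp.ext h)
  have h := hT.eq_zero_of_forall (L := fun f => ω y * f x - ω x * f y)
    (((CpSpace.continuous_eval x).const_mul _).sub ((CpSpace.continuous_eval y).const_mul _))
    (fun f => by simp only [weightedComp_apply, hxy]; ring) (CpSpace.coordSub i (y.1 i))
  simp only [CpSpace.coordSub_apply, sub_self, RCLike.ofReal_zero, mul_zero, sub_zero,
    mul_eq_zero, weight_ne_zero hT y, false_or, RCLike.ofReal_eq_zero] at h
  exact hi (sub_eq_zero.1 h)

theorem fderiv_weightedComp (hp : 1 ≤ p) (f : CpSpace 𝕜 Ω p) (x : Ω)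
    (v : EuclideanSpace ℝ (Fin d)) :
    fderiv ℝ (Function.extend Subtype.val (weightedComp ω hω ψ hψ f) 0)
      (x : EuclideanSpace ℝ (Fin d)) v =
    ω x * fderiv ℝ (Function.extend Subtype.val f 0) (ψ x : EuclideanSpace ℝ (Fin d))
      (fderiv ℝ (Function.extend Subtype.val (fun x => (ψ x : EuclideanSpace ℝ (Fin d))) 0)
        (x : EuclideanSpace ℝ (Fin d)) v) +
    f (ψ x) * fderiv ℝ (Function.extend Subtype.val ω 0) (x : EuclideanSpace ℝ (Fin d)) v := by
  have hp' : (p : WithTop ℕ∞) ≠ 0 := by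
    exact_mod_cast (zero_lt_one.trans_le hp).ne'
  set Ψ := Function.extend Subtype.val (fun x => (ψ x : EuclideanSpace ℝ (Fin d))) 0 with hΨ
  have e : Ψ (x : EuclideanSpace ℝ (Fin d)) = ψ x := extend_val_apply _ x
  have h1 := ((hψ.contDiffAt x).differentiableAt hp').hasFDerivAt
  have h2 := ((f.isCp.contDiffAt (ψ x)).differentiableAt hp').hasFDerivAt
  have h3 := ((hω.contDiffAt x).differentiableAt hp').hasFDerivAt
  rw [← hΨ] at h1
  rw [← e] at h2
  have h4 := h3.mul (h2.comp _ h1)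
  have h5 : Function.extend Subtype.val (weightedComp ω hω ψ hψ f) 0 =ᶠ[𝓝 x.1]
      Function.extend Subtype.val ω 0 * (Function.extend Subtype.val f 0 ∘ Ψ) := by
    refine extend_val_eventuallyEq (Eventually.of_forall fun y => ?_)
    have e' : Ψ (y : EuclideanSpace ℝ (Fin d)) = ψ y := extend_val_apply _ y
    simp only [weightedComp_apply, Pi.mul_apply, Function.comp_apply, e', extend_val_apply]
  rw [h5.fderiv_eq, h4.fderiv]
  simp [e]

/-- If the derivative of `ψ` at `x` kills `v`, the product rule leaves `∂_v (T f)(x) = f (ψ x) * ∂_v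
ω(x)`. Hence `ω x * ∂_v f(x) - ∂_v ω(x) * f x` vanishes on the range, and coordinates centred at `x`
give `v = 0`. -/
theorem fderiv_symbol_injective (hp : 1 ≤ p) (hT : IsTransitiveOp (weightedComp ω hω ψ hψ))
    (x : Ω) : Function.Injective
      (fderiv ℝ (Function.extend Subtype.val (fun x => (ψ x : EuclideanSpace ℝ (Fin d))) 0)
        (x : EuclideanSpace ℝ (Fin d))) := by
  rw [injective_iff_map_eq_zero]
  intro v hv
  have h := fun f => hT.eq_zero_of_forall (L := fun f : CpSpace 𝕜 Ω p =>
      ω x * fderiv ℝ (Function.extend Subtype.val f 0) (x : EuclideanSpace ℝ (Fin d)) v -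
      fderiv ℝ (Function.extend Subtype.val ω 0) (x : EuclideanSpace ℝ (Fin d)) v * f x)
    (((CpSpace.continuous_fderiv_apply hp x v).const_mul _).sub
      ((CpSpace.continuous_eval x).const_mul _))
    (fun f => by
      rw [fderiv_weightedComp hp, hv, weightedComp_apply, map_zero]
      ring) f
  ext i
  have hi := h (CpSpace.coordSub i (x.1 i))
  rw [CpSpace.fderiv_coordSub, CpSpace.coordSub_apply] at hi
  simpa [weight_ne_zero hT x] using hi

/-- The weight is the product of `ω` along the orbit; what matters later is that it does not depend
on `f`. -/
theorem exists_weight_pow (n : ℕ) : ∃ w : Ω → 𝕜, ∀ (f : CpSpace 𝕜 Ω p) (x : Ω),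
    (weightedComp ω hω ψ hψ ^ n) f x = w x * f (ψ^[n] x) := by
  induction n with
  | zero => exact ⟨fun _ => 1, fun f x => by simp⟩
  | succ n ih =>
    obtain ⟨w, hw⟩ := ih
    refine ⟨fun x => w x * ω (ψ^[n] x), fun f x => ?_⟩
    rw [pow_succ, Module.End.mul_apply, hw, weightedComp_apply, Function.iterate_succ_apply',
      mul_assoc]

/-- The symbol of a mixing weighted composition operator is strongly run-away. -/
theorem IsMixingOp.exists_disjoint_iterate (hT : IsMixingOp (weightedComp ω hω ψ hψ)) {K : Set Ω}
    (hK : IsCompact K) : ∃ N, ∀ n, N ≤ n → ∀ x ∈ K, ψ^[n] x ∉ K := by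
  let K' : Compacts Ω := ⟨K, hK⟩
  let R := CpSpace.restrictOn (𝕜 := 𝕜) (p := p) K'
  have hR : Continuous R := CpSpace.continuous_restrictOn K'
  let U : Set (CpSpace 𝕜 Ω p) := R ⁻¹' Metric.ball 0 1
  let V : Set (CpSpace 𝕜 Ω p) := R ⁻¹' Metric.ball (ContinuousMap.const _ 2) 1
  have hU : IsOpen U := Metric.isOpen_ball.preimage hR
  have hV : IsOpen V := Metric.isOpen_ball.preimage hR
  have hU0 : U.Nonempty := ⟨0, by simp [U]⟩
  have hV0 : V.Nonempty := by
    refine ⟨CpSpace.ofContDiff (fun _ => 2) contDiff_const, ?_⟩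
    have : R (CpSpace.ofContDiff (fun _ => 2) contDiff_const) = ContinuousMap.const _ 2 := by
      ext x
      rw [CpSpace.restrictOn_apply]
      rfl
    simp [V, this]
  have hUlt : ∀ f ∈ U, ∀ x ∈ K, ‖f x‖ < 1 := by
    intro f hf x hx
    have h1 : ‖R f‖ < 1 := by simpa [U] using hf
    have h2 := (ContinuousMap.norm_coe_le_norm (R f) ⟨x, hx⟩).trans_lt h1
    rwa [CpSpace.restrictOn_apply] at h2
  have hVlt : ∀ f ∈ V, ∀ x ∈ K, 1 < ‖f x‖ := by
    intro f hf x hx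
    have h1 : ‖R f - ContinuousMap.const _ 2‖ < 1 := by
      simpa [V, dist_eq_norm] using hf
    have h2 := (ContinuousMap.norm_coe_le_norm (R f - ContinuousMap.const _ 2)
      ⟨x, hx⟩).trans_lt h1
    rw [ContinuousMap.sub_apply, CpSpace.restrictOn_apply, ContinuousMap.const_apply,
      norm_sub_rev] at h2
    have h3 := norm_sub_norm_le (2 : 𝕜) (f x)
    rw [RCLike.norm_ofNat] at h3
    linarith
  -- Mixing allows the same `n` in both directions. If `x` and `ψ^n x` lie in `K`, passing from `U`
  -- to `V` forces `‖w x‖ > 1`, and from `V` to `U` forces `‖w x‖ < 1`.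
  obtain ⟨N₁, hN₁⟩ := hT U V hU hV hU0 hV0
  obtain ⟨N₂, hN₂⟩ := hT V U hV hU hV0 hU0
  refine ⟨max N₁ N₂, fun n hn x hx hx' => ?_⟩
  obtain ⟨w, hw⟩ := exists_weight_pow (ω := ω) (hω := hω) (ψ := ψ) (hψ := hψ) n
  obtain ⟨_, ⟨f, hf, rfl⟩, hf'⟩ := hN₁ n ((le_max_left _ _).trans hn)
  obtain ⟨_, ⟨g, hg, rfl⟩, hg'⟩ := hN₂ n ((le_max_right _ _).trans hn)
  have a1 := hVlt _ hf' x hx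
  have a2 := hUlt _ hf _ hx'
  have a3 := hUlt _ hg' x hx
  have a4 := hVlt _ hg _ hx'
  rw [hw, norm_mul] at a1 a3
  have b := norm_nonneg (w x)
  rcases le_total 1 ‖w x‖ with h | h <;> nlinarith [norm_nonneg (f (ψ^[n] x))]

end necessity

/-! ### Construction of periodic points. -/

section periodic

variable {𝕜 : Type*} [RCLike 𝕜] {d : ℕ} {Ω : Opens (EuclideanSpace ℝ (Fin d))} {p : ℕ∞}

/-- A locally stationary sequence in `C^p(Ω, 𝕜)` has a locally attained limit. -/
theorem CpSpace.exists_eq_of_locally_stationary (G : ℕ → CpSpace 𝕜 Ω p)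
    (hG : ∀ L : Set Ω, IsCompact L → ∃ J₀, ∀ J, J₀ ≤ J → ∀ x ∈ L, G J x = G J₀ x) :
    ∃ g : CpSpace 𝕜 Ω p, ∀ L : Set Ω, IsCompact L → ∃ J₀, ∀ J, J₀ ≤ J → ∀ x ∈ L, g x = G J x := by
  have hpt : ∀ x, ∃ J₀, ∀ J, J₀ ≤ J → G J x = G J₀ x := fun x => by
    obtain ⟨J₀, h⟩ := hG {x} isCompact_singleton
    exact ⟨J₀, fun J hJ => h J hJ x rfl⟩
  choose j hj using hpt
  have key : ∀ L : Set Ω, IsCompact L → ∃ J₀, ∀ J, J₀ ≤ J → ∀ x ∈ L, G (j x) x = G J x := by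
    intro L hL
    obtain ⟨J₀, h⟩ := hG L hL
    refine ⟨J₀, fun J hJ x hx => ?_⟩
    rw [h J hJ x hx, ← hj x _ (le_max_left (j x) J₀), h _ (le_max_right (j x) J₀) x hx]
  have : LocallyCompactSpace Ω := Ω.isOpen.isOpenEmbedding_subtypeVal.locallyCompactSpace
  refine ⟨CpSpace.mk (fun x => G (j x) x) (isCp_of_locally fun x => ?_), key⟩
  obtain ⟨L, hL, hx⟩ := exists_compact_mem_nhds x
  obtain ⟨J, hJ⟩ := key L hL
  refine ⟨_, (G J).isCp.contDiffAt x, ?_⟩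
  filter_upwards [hx] with y hy
  rw [hJ J le_rfl y hy, extend_val_apply]

/-- Division by the weight and transport along an injective symbol, extended by zero, preserve
smoothness of compactly supported functions. -/
theorem CpSpace.exists_preimage (hp : 1 ≤ p) {ω : Ω → 𝕜} (hω : IsCp p ω) {ψ : Ω → Ω}
    (hψ : IsCp p fun x => (ψ x : EuclideanSpace ℝ (Fin d))) (hω0 : ∀ x, ω x ≠ 0)
    (hinj : Function.Injective ψ)
    (hder : ∀ x : Ω, Function.Injective
      (fderiv ℝ (Function.extend Subtype.val (fun x => (ψ x : EuclideanSpace ℝ (Fin d))) 0)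
        (x : EuclideanSpace ℝ (Fin d))))
    {K : Set Ω} (hK : IsCompact K) (h : CpSpace 𝕜 Ω p) (hh : ∀ x ∉ K, h x = 0) :
    ∃ s : CpSpace 𝕜 Ω p, weightedComp ω hω ψ hψ s = h ∧ ∀ y ∉ ψ '' K, s y = 0 := by
  have hp' : (p : WithTop ℕ∞) ≠ 0 := by
    exact_mod_cast (zero_lt_one.trans_le hp).ne'
  let S : Ω → 𝕜 := Function.extend ψ (fun x => h x / ω x) 0
  have hS : ∀ x, S (ψ x) = h x / ω x := fun x => hinj.extend_apply _ _ x
  have hS0 : ∀ y ∉ ψ '' K, S y = 0 := by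
    intro y hy
    by_cases hy' : ∃ x, ψ x = y
    · obtain ⟨x, rfl⟩ := hy'
      rw [hS, hh x fun hx => hy ⟨x, hx, rfl⟩, zero_div]
    · exact Function.extend_apply' _ _ _ hy'
  have hcp : IsCp p S := by
    refine isCp_of_locally fun y => ?_
    by_cases hy : y ∈ ψ '' K
    · obtain ⟨x, -, rfl⟩ := hy
      set Ψ := Function.extend Subtype.val (fun x => (ψ x : EuclideanSpace ℝ (Fin d))) 0 with hΨ
      have hΨv : ∀ x : Ω, Ψ (x : EuclideanSpace ℝ (Fin d)) = ψ x := fun x => extend_val_apply _ x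
      have hc : ContDiffAt ℝ p Ψ x.1 := hψ.contDiffAt x
      -- An injective endomorphism in finite dimension is invertible, so the inverse function
      -- theorem applies; near `ψ x`, `S` is `(h / ω) ∘ θ` with `θ` the local inverse.
      let e : EuclideanSpace ℝ (Fin d) ≃L[ℝ] EuclideanSpace ℝ (Fin d) :=
        (LinearEquiv.ofInjectiveEndo (fderiv ℝ Ψ x.1 : _ →ₗ[ℝ] _)
          (hder x)).toContinuousLinearEquiv
      have hd : HasFDerivAt Ψ (e : EuclideanSpace ℝ (Fin d) →L[ℝ] EuclideanSpace ℝ (Fin d)) x.1 := by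
        convert! (hc.differentiableAt hp').hasFDerivAt using 1
      let θ := hc.localInverse hd hp'
      have hθ : ContDiffAt ℝ p θ (Ψ x) := hc.to_localInverse hd hp'
      have hθx : θ (Ψ x) = x := hc.localInverse_apply_image hd hp'
      have hr : ∀ᶠ z in 𝓝 (Ψ x), Ψ (θ z) = z :=
        (hc.hasStrictFDerivAt' hd hp').eventually_right_inverse
      have hmem : ∀ᶠ z in 𝓝 (Ψ x), θ z ∈ Ω :=
        hθ.continuousAt.eventually_mem (by rw [hθx]; exact Ω.isOpen.mem_nhds x.2)
      have hω' := hω.contDiffAt x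
      have hh' := h.isCp.contDiffAt x
      rw [← hθx] at hω' hh'
      have hq := (hh'.comp _ hθ).mul ((hω'.comp _ hθ).inv (by
        rw [Function.comp_apply, hθx, extend_val_apply]
        exact hω0 x))
      rw [hΨv] at hq hr hmem
      refine ⟨_, hq, ?_⟩
      filter_upwards [continuous_subtype_val.continuousAt.eventually hr,
        continuous_subtype_val.continuousAt.eventually hmem] with z hz hz'
      have hz2 : ψ ⟨θ z, hz'⟩ = z := Subtype.ext ((hΨv ⟨θ z, hz'⟩).symm.trans hz)
      have e1 := extend_val_apply (h : Ω → 𝕜) ⟨θ z, hz'⟩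
      have e2 := extend_val_apply ω ⟨θ z, hz'⟩
      have e3 := hS ⟨θ z, hz'⟩
      simp only [Pi.inv_apply, Function.comp_apply]
      rw [e1, e2, ← div_eq_mul_inv, ← e3, hz2]
    · refine ⟨fun _ => 0, contDiffAt_const, ?_⟩
      -- `ψ '' K` is compact, hence closed, so `S` vanishes near `y` even if `y` is a limit of
      -- points of the range of `ψ`.
      have hcl : IsClosed (ψ '' K) := (hK.image (continuous_of_isCp_val hψ)).isClosed
      filter_upwards [hcl.isOpen_compl.mem_nhds hy] with z hz using hS0 z hz
  refine ⟨CpSpace.mk S hcp, CpSpace.ext_apply fun x => ?_, hS0⟩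
  rw [weightedComp_apply, CpSpace.coe_mk, hS, mul_div_cancel₀ _ (hω0 x)]

/-- Cutting off a `C^p` function. -/
theorem CpSpace.exists_cutoff (f : CpSpace 𝕜 Ω p) (K : Compacts Ω) :
    ∃ (K' : Set Ω) (h : CpSpace 𝕜 Ω p), IsCompact K' ∧ (∀ x ∉ K', h x = 0) ∧
      ∀ x ∈ K, ∀ᶠ y in 𝓝 x, y ∈ K' ∧ h y = f y := by
  have : LocallyCompactSpace Ω := Ω.isOpen.isOpenEmbedding_subtypeVal.locallyCompactSpace
  obtain ⟨K', hK', hKK'⟩ := exists_compact_superset K.isCompact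
  have hsub : (Subtype.val '' (K : Set Ω) : Set (EuclideanSpace ℝ (Fin d))) ⊆
      interior (Subtype.val '' K') :=
    (Set.image_mono hKK').trans (interior_maximal (Set.image_mono interior_subset)
      (Ω.isOpen.isOpenMap_subtype_val _ isOpen_interior))
  obtain ⟨χ, h1, h0, -⟩ := exists_contMDiffMap_one_nhds_of_subset_interior
    (n := p) (modelWithCornersSelf ℝ (EuclideanSpace ℝ (Fin d)))
    (K.isCompact.image continuous_subtype_val).isClosed hsub
  have hχ : ContDiff ℝ p χ := χ.contMDiff.contDiff
  have hcp : IsCp p fun x : Ω => χ x • f x := by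
    refine (isCp_iff_of_eqOn (g := fun x => χ x • Function.extend Subtype.val f 0 x)
      fun x => ?_).2 (hχ.contDiffOn.smul f.isCp)
    rw [extend_val_apply]
  refine ⟨K', CpSpace.mk _ hcp, hK', fun x hx => ?_, fun x hx => ?_⟩
  · rw [CpSpace.coe_mk, h0 x, zero_smul]
    rintro ⟨y, hy, hyx⟩
    exact hx (Subtype.ext hyx ▸ hy)
  · have h1x := (eventually_nhdsSet_iff_forall.1 h1) x ⟨x, hx, rfl⟩
    filter_upwards [mem_interior_iff_mem_nhds.1 (hKK' hx),
      continuous_subtype_val.continuousAt.eventually h1x] with y hy hy'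
    exact ⟨hy, by rw [CpSpace.coe_mk, hy', one_smul]⟩

/-- Telescoping: a two-sided orbit segment is invariant up to its end terms. -/
theorem map_sum_orbit_segment {R X : Type*} [Semiring R] [AddCommGroup X] [Module R X]
    (A : X →ₗ[R] X) (r s : ℕ → X) (h0 : r 0 = s 0) (hr : ∀ j, A (r j) = r (j + 1))
    (hs : ∀ j, A (s (j + 1)) = s j) (J : ℕ) :
    A (∑ j ∈ Finset.range J, r j + ∑ j ∈ Finset.range J, s (j + 1)) =
      (∑ j ∈ Finset.range J, r j + ∑ j ∈ Finset.range J, s (j + 1)) + r J - s J := by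
  simp only [map_add, map_sum, hr, hs]
  have h1 := Finset.sum_range_succ' r J
  have h2 := Finset.sum_range_succ' s J
  rw [Finset.sum_range_succ] at h1 h2
  rw [eq_sub_of_add_eq h1.symm, eq_sub_of_add_eq h2, h0]
  abel

/-- If the symbol of an injective weighted composition operator is strongly run-away and a local
diffeomorphism, then every `C^p` function coincides near a given compact set with a periodic
point. -/
theorem exists_periodic_eventually_eq (hp : 1 ≤ p) {ω : Ω → 𝕜} (hω : IsCp p ω) {ψ : Ω → Ω}
    (hψ : IsCp p fun x => (ψ x : EuclideanSpace ℝ (Fin d))) (hω0 : ∀ x, ω x ≠ 0)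
    (hinj : Function.Injective ψ)
    (hder : ∀ x : Ω, Function.Injective
      (fderiv ℝ (Function.extend Subtype.val (fun x => (ψ x : EuclideanSpace ℝ (Fin d))) 0)
        (x : EuclideanSpace ℝ (Fin d))))
    (hrun : ∀ K : Set Ω, IsCompact K → ∃ N, ∀ n, N ≤ n → ∀ x ∈ K, ψ^[n] x ∉ K)
    (f : CpSpace 𝕜 Ω p) (K : Compacts Ω) :
    ∃ N, 1 ≤ N ∧ ∃ g : CpSpace 𝕜 Ω p, (weightedComp ω hω ψ hψ ^ N) g = g ∧
      ∀ x ∈ K, ∀ᶠ y in 𝓝 x, g y = f y := by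
  set T := weightedComp ω hω ψ hψ with hTdef
  obtain ⟨K', h, hK', hh0, hhf⟩ := f.exists_cutoff K
  have hψc : Continuous ψ := continuous_of_isCp_val hψ
  -- the backward orbit of `h`
  have hstep : ∀ (n : ℕ) (u : {u : CpSpace 𝕜 Ω p // ∀ y ∉ ψ^[n] '' K', u y = 0}),
      ∃ v : {v : CpSpace 𝕜 Ω p // ∀ y ∉ ψ^[n + 1] '' K', v y = 0}, T v.1 = u.1 := by
    rintro n ⟨u, hu⟩
    obtain ⟨v, hv, hv0⟩ := CpSpace.exists_preimage hp hω hψ hω0 hinj hder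
      (hK'.image (hψc.iterate n)) u hu
    refine ⟨⟨v, fun y hy => hv0 y ?_⟩, hv⟩
    rwa [Set.image_image, ← funext fun x => Function.iterate_succ_apply' ψ n x]
  choose B hB using hstep
  let b : ∀ n : ℕ, {u : CpSpace 𝕜 Ω p // ∀ y ∉ ψ^[n] '' K', u y = 0} := fun n =>
    Nat.rec ⟨h, by simpa using hh0⟩ (fun n u => B n u) n
  have hb : ∀ n, T (b (n + 1)).1 = (b n).1 := fun n => hB n (b n)
  have hbpow : ∀ m n, (T ^ m) (b (n + m)).1 = (b n).1 := by
    intro m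
    induction m with
    | zero => intro n; simp
    | succ m ih => intro n; rw [pow_succ, Module.End.mul_apply, ← add_assoc, hb, ih]
  have hT0 : ∀ n x, ψ^[n] x ∉ K' → (T ^ n) h x = 0 := by
    intro n x hx
    obtain ⟨w, hw⟩ := exists_weight_pow (ω := ω) (hω := hω) (ψ := ψ) (hψ := hψ) n
    rw [hTdef, hw, hh0 _ hx, mul_zero]
  obtain ⟨N₀, hN₀⟩ := hrun K' hK'
  obtain ⟨N, hN1, hN⟩ : ∃ N, 1 ≤ N ∧ ∀ n, N ≤ n → ∀ x ∈ K', ψ^[n] x ∉ K' :=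
    ⟨max N₀ 1, le_max_right _ _, fun n hn => hN₀ n ((le_max_left _ _).trans hn)⟩
  let r : ℕ → CpSpace 𝕜 Ω p := fun j => (T ^ (N * j)) h
  let s : ℕ → CpSpace 𝕜 Ω p := fun j => (b (N * j)).1
  -- Symmetric partial sums of the bilateral series; the shift `j + 1` keeps `h = r 0 = s 0` from
  -- being counted twice.
  let G : ℕ → CpSpace 𝕜 Ω p := fun J =>
    ∑ j ∈ Finset.range J, r j + ∑ j ∈ Finset.range J, s (j + 1)
  have hGinv : ∀ J, (T ^ N) (G J) = G J + r J - s J := fun J =>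
    map_sum_orbit_segment (T ^ N) r s rfl
      (fun j => by
        change (T ^ N) ((T ^ (N * j)) h) = (T ^ (N * (j + 1))) h
        rw [← Module.End.mul_apply, ← pow_add, mul_add_one, add_comm])
      (fun j => hbpow N (N * j)) J
  have hGsucc : ∀ J x, G (J + 1) x = G J x + r J x + s (J + 1) x := by
    intro J x
    simp only [G, Finset.sum_range_succ, CpSpace.add_apply]
    ring
  have hvanish : ∀ L : Set Ω, IsCompact L → ∃ J₀, ∀ J, J₀ ≤ J → ∀ x ∈ L, r J x = 0 ∧ s J x = 0 := by
    intro L hL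
    -- Run-away for the union separates `ψ^n(L)` from `K'` (forward terms) and `ψ^n(K')` from `L`
    -- (backward terms).
    obtain ⟨M, hM⟩ := hrun (K' ∪ L) (hK'.union hL)
    refine ⟨M, fun J hJ x hx => ?_⟩
    have hJ' : M ≤ N * J := hJ.trans (Nat.le_mul_of_pos_left J hN1)
    refine ⟨hT0 _ _ fun hx' => hM _ hJ' x (Or.inr hx) (Or.inl hx'), (b (N * J)).2 x ?_⟩
    rintro ⟨y, hy, rfl⟩
    exact hM _ hJ' y (Or.inl hy) (Or.inr hx)
  have hstat : ∀ (L : Set Ω) (J₀ : ℕ), (∀ J, J₀ ≤ J → ∀ x ∈ L, r J x = 0 ∧ s (J + 1) x = 0) →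
      ∀ J, J₀ ≤ J → ∀ x ∈ L, G J x = G J₀ x := by
    intro L J₀ h0 J hJ x hx
    induction J, hJ using Nat.le_induction with
    | base => rfl
    | succ J hJ ih => rw [hGsucc, ih, (h0 J hJ x hx).1, (h0 J hJ x hx).2, add_zero, add_zero]
  obtain ⟨g, hg⟩ := CpSpace.exists_eq_of_locally_stationary G fun L hL => by
    obtain ⟨J₀, h0⟩ := hvanish L hL
    exact ⟨J₀, hstat L J₀ fun J hJ x hx =>
      ⟨(h0 J hJ x hx).1, (h0 (J + 1) (hJ.trans (Nat.le_succ J)) x hx).2⟩⟩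
  refine ⟨N, hN1, g, CpSpace.ext_apply fun x => ?_, fun x hx => ?_⟩
  -- `(T ^ N) g` at `x` only involves `g` at `ψ^[N] x`, so a partial sum exact at both points, with
  -- end terms vanishing at `x`, suffices.
  · have hL : IsCompact ({x, ψ^[N] x} : Set Ω) := (Set.toFinite _).isCompact
    obtain ⟨J₁, h₁⟩ := hg _ hL
    obtain ⟨J₂, h₂⟩ := hvanish _ hL
    set J := max J₁ J₂
    have a1 := h₁ J (le_max_left _ _) x (by simp)
    have a2 := h₁ J (le_max_left _ _) (ψ^[N] x) (by simp)
    have a3 := h₂ J (le_max_right _ _) x (by simp)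
    obtain ⟨w, hw⟩ := exists_weight_pow (ω := ω) (hω := hω) (ψ := ψ) (hψ := hψ) N
    rw [hTdef, hw, a2, ← hw, ← hTdef, hGinv, CpSpace.sub_apply, CpSpace.add_apply, a3.1, a3.2,
      add_zero, sub_zero, a1]
  -- By the choice of `N`, the partial sums are constant on `K'` from index `1` on, so there `g = G
  -- 1 = h + s 1 = h`.
  · have hK'0 : ∀ J, 1 ≤ J → ∀ y ∈ K', r J y = 0 ∧ s (J + 1) y = 0 := by
      intro J hJ y hy
      refine ⟨hT0 _ _ (hN _ (Nat.le_mul_of_pos_right N hJ) y hy), (b (N * (J + 1))).2 y ?_⟩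
      rintro ⟨z, hz, rfl⟩
      exact hN _ (Nat.le_mul_of_pos_right N J.succ_pos) z hz hy
    obtain ⟨J₁, h₁⟩ := hg K' hK'
    filter_upwards [hhf x hx] with y hy
    rw [h₁ (max J₁ 1) (le_max_left _ _) y hy.1,
      hstat K' 1 hK'0 (max J₁ 1) (le_max_right _ _) y hy.1, ← hy.2]
    have hs1 : s 1 y = 0 := by
      refine (b (N * 1)).2 y ?_
      rintro ⟨z, hz, rfl⟩
      exact hN _ (by simp) z hz hy.1
    simp [G, hs1, r]

end periodic

theorem theorem3p1 {𝕜 : Type*} [RCLike 𝕜] {d : ℕ} (Ω : Opens (EuclideanSpace ℝ (Fin d)))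
    (p : ℕ∞) (hp : 1 ≤ p)
    (ψ : Ω → Ω) (hψ : IsCp p fun x => (ψ x : EuclideanSpace ℝ (Fin d)))
    (ω : Ω → 𝕜) (hω : IsCp p ω)
    (hmix : IsMixingOp (weightedComp ω hω ψ hψ)) :
    IsChaoticOp (weightedComp ω hω ψ hψ) := by
  have hT := hmix.isTransitiveOp
  refine ⟨hT, fun f => CpSpace.mem_closure_of_eventually_eq fun K => ?_⟩
  obtain ⟨N, hN, g, hg, hgf⟩ := exists_periodic_eventually_eq hp hω hψ (weight_ne_zero hT)
    (symbol_injective hT) (fderiv_symbol_injective hp hT)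
    (fun K hK => hmix.exists_disjoint_iterate hK) f K
  refine ⟨g, Set.mem_iUnion₂.2 ⟨N, hN, ?_⟩, hgf⟩
  rw [SetLike.mem_coe, LinearMap.mem_ker, LinearMap.sub_apply, hg, LinearMap.id_apply, sub_self]


end
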